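/- Let $m,n\ge 2$ be integers, let $L$ be a field in which $m$ is invertible, and let $\chi_1,\dots,\chi_n\in L^\ast$. Let $X=X_{\chi_1,\dots,\chi_n}\subset\mathbb P^{2^n-1}_L$ be the hypersurface of degree $m$ (the Fermat–Pfister hypersurface) given by $$\sum_{\epsilon\in\{0,1\}^n}(-\chi_1)^{\epsilon_1}(-\chi_2)^{\epsilon_2}\cdots(-\chi_n)^{\epsilon_n}\cdot y_{\phi(\epsilon)}^m=0,\qquad \phi(\epsilon)=\sum_{i=1}^n\epsilon_i\,2^{i-1},$$ where $y_0,\dots,y_{2^n-1}$ are the homogeneous coordinates. Then $X$ is smooth over $L$. Moreover, let $Y$ be a variety over $L$ (an integral separated scheme of finite type over $L$) which admits a morphism $\iota:Y\to X$ of $L$-schemes. Then $$(\chi_1,\dots,\chi_n)\in\ker\left(K^M_n(L)/m\longrightarrow K^M_n(L(Y))/m\right),$$ where $L(Y)$ is the function field of $Y$, $K^M_n(F)$ is the $n$-th Milnor K-group of a field $F$, i.e. the quotient of $(F^\ast)^{\otimes n}$ (tensor power over $\mathbb Z$) by the subgroup generated by the tensors $a_1\otimes\cdots\otimes a_n$ with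 $a_i+a_{i+1}=1$ for some $1\le i\le n-1$, and $(\chi_1,\dots,\chi_n)$ is the class of $\chi_1\otimes\cdots\otimes\chi_n$. -/

import Mathlib

open CategoryTheory AlgebraicGeometry
open scoped TensorProduct DirectSum

universe u v

noncomputable section

/-! ## Milnor K-theory -/

/-- The `n`-fold tensor power over `ℤ` of the group of units of `R`. -/
abbrev UnitsTensorPower (R : Type u) [CommRing R] (n : ℕ) : Type u :=
  ⨂[ℤ] _ : Fin n, Additive Rˣ

/-- The pure tensor `a₁ ⊗ ⋯ ⊗ aₙ`. -/
def unitsTprod {R : Type u} [CommRing R] {n : ℕ} (a : Fin n → Rˣ) : UnitsTensorPower R n :=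
  PiTensorProduct.tprod ℤ (fun i => Additive.ofMul (a i))

/-- The subgroup generated by the tensors `a₁ ⊗ ⋯ ⊗ aₙ` with `aᵢ + aᵢ₊₁ = 1` for some `i`. -/
def steinbergRelations (R : Type u) [CommRing R] (n : ℕ) : Submodule ℤ (UnitsTensorPower R n) :=
  Submodule.span ℤ {t | ∃ (a : Fin n → Rˣ) (i j : Fin n),
    (j : ℕ) = (i : ℕ) + 1 ∧ (a i : R) + (a j : R) = 1 ∧ t = unitsTprod a}

/-- The Milnor K-group `K_n^M(R)`. -/
abbrev MilnorK (R : Type u) [CommRing R] (n : ℕ) : Type u :=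
  UnitsTensorPower R n ⧸ steinbergRelations R n

/-- `K_n^M(R)/m`, the quotient of `K_n^M(R)` by its `m`-th multiples. -/
abbrev MilnorKMod (R : Type u) [CommRing R] (n m : ℕ) : Type u :=
  MilnorK R n ⧸ LinearMap.range (LinearMap.lsmul ℤ (MilnorK R n) (m : ℤ))

/-- The symbol `(a₁, …, aₙ)` in `K_n^M(R)/m`. -/
def milnorSymbol {R : Type u} [CommRing R] {n : ℕ} (m : ℕ) (a : Fin n → Rˣ) :
    MilnorKMod R n m :=
  Submodule.Quotient.mk (Submodule.Quotient.mk (unitsTprod a))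

/-- The map on tensor powers of unit groups induced by a ring homomorphism. -/
def unitsTensorPowerMap {R : Type u} {S : Type v} [CommRing R] [CommRing S] (f : R →+* S) (n : ℕ) :
    UnitsTensorPower R n →ₗ[ℤ] UnitsTensorPower S n :=
  PiTensorProduct.map
    (fun _ => (MonoidHom.toAdditive (Units.map (f : R →* S))).toIntLinearMap)

theorem unitsTensorPowerMap_tprod {R : Type u} {S : Type v} [CommRing R] [CommRing S]
    (f : R →+* S) {n : ℕ} (a : Fin n → Rˣ) :
    unitsTensorPowerMap f n (unitsTprod a) =
      unitsTprod (fun i => Units.map (f : R →* S) (a i)) := by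
  simp only [unitsTensorPowerMap, unitsTprod, PiTensorProduct.map_tprod]
  rfl

theorem steinbergRelations_le_comap {R : Type u} {S : Type v} [CommRing R] [CommRing S]
    (f : R →+* S) (n : ℕ) :
    steinbergRelations R n ≤ (steinbergRelations S n).comap (unitsTensorPowerMap f n) := by
  refine Submodule.span_le.2 ?_
  rintro t ⟨a, i, j, hij, h, rfl⟩
  refine Submodule.subset_span
    ⟨fun i => Units.map (f : R →* S) (a i), i, j, hij, ?_, unitsTensorPowerMap_tprod f a⟩
  simpa using congrArg f h

/-- The homomorphism `K_n^M(R) → K_n^M(S)` induced by a ring homomorphism `R → S`. -/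
def milnorKMap {R : Type u} {S : Type v} [CommRing R] [CommRing S] (f : R →+* S) (n : ℕ) :
    MilnorK R n →ₗ[ℤ] MilnorK S n :=
  Submodule.mapQ _ _ (unitsTensorPowerMap f n) (steinbergRelations_le_comap f n)

/-- The homomorphism `K_n^M(R)/m → K_n^M(S)/m` induced by a ring homomorphism `R → S`. -/
def milnorKModMap {R : Type u} {S : Type v} [CommRing R] [CommRing S] (f : R →+* S) (n m : ℕ) :
    MilnorKMod R n m →ₗ[ℤ] MilnorKMod S n m :=
  Submodule.mapQ _ _ (milnorKMap f n) (by
    rintro _ ⟨x, rfl⟩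
    exact ⟨milnorKMap f n x, by simp⟩)

theorem milnorKModMap_symbol {R : Type u} {S : Type v} [CommRing R] [CommRing S] (f : R →+* S)
    {n : ℕ} (m : ℕ) (a : Fin n → Rˣ) :
    milnorKModMap f n m (milnorSymbol m a) =
      milnorSymbol m (fun i => Units.map (f : R →* S) (a i)) := by
  simp only [milnorKModMap, milnorKMap, milnorSymbol, ← unitsTensorPowerMap_tprod]
  rfl

/-! ## The graded quotient of a graded algebra by a homogeneous ideal -/

section GradedQuotient

variable {k A : Type u} [CommRing k] [CommRing A] [Algebra k A]
  (𝒜 : ℕ → Submodule k A) [GradedAlgebra 𝒜] (I : HomogeneousIdeal 𝒜)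

/-- The grading on `A ⧸ I`: the degree `i` part is the image of the degree `i` part of `A`. -/
def quotientGrading (i : ℕ) : Submodule k (A ⧸ I.toIdeal) :=
  (𝒜 i).map (Ideal.Quotient.mkₐ k I.toIdeal).toLinearMap

instance quotientGrading.gradedMonoid : SetLike.GradedMonoid (quotientGrading 𝒜 I) where
  one_mem := ⟨1, SetLike.one_mem_graded 𝒜, by simp⟩
  mul_mem := by
    rintro i j _ _ ⟨a, ha, rfl⟩ ⟨b, hb, rfl⟩
    exact ⟨a * b, SetLike.mul_mem_graded ha hb, by simp⟩

/-- The projection `A_i → (A ⧸ I)_i`. -/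
def quotientGrading.proj (i : ℕ) : 𝒜 i →ₗ[k] quotientGrading 𝒜 I i :=
  ((Ideal.Quotient.mkₐ k I.toIdeal).toLinearMap.comp (𝒜 i).subtype).codRestrict _
    (fun x => ⟨x, x.2, rfl⟩)

/-- The map `A → ⨁ i, (A ⧸ I)_i` sending `a` to the classes of its homogeneous components. -/
def quotientGrading.components : A →ₐ[k] ⨁ i, quotientGrading 𝒜 I i :=
  (DirectSum.toAlgebra k (fun i => 𝒜 i)
    (fun i => (DirectSum.lof k ℕ (fun i => quotientGrading 𝒜 I i) i).comp
      (quotientGrading.proj 𝒜 I i))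
    (by rfl)
    (by
      intro i j a b
      simp only [LinearMap.comp_apply, DirectSum.lof_eq_of, DirectSum.of_mul_of]
      rfl)).comp (DirectSum.decomposeAlgEquiv 𝒜).toAlgHom

theorem quotientGrading.components_of_mem {i : ℕ} {a : A} (ha : a ∈ 𝒜 i) :
    quotientGrading.components 𝒜 I a =
      DirectSum.of (fun i => quotientGrading 𝒜 I i) i ⟨Ideal.Quotient.mk _ a, ⟨a, ha, rfl⟩⟩ := by
  have : DirectSum.decomposeAlgEquiv 𝒜 a = DirectSum.of (fun i => 𝒜 i) i ⟨a, ha⟩ :=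
    DirectSum.decompose_of_mem 𝒜 ha
  simp only [quotientGrading.components, AlgHom.comp_apply]
  erw [this, DirectSum.toAlgebra_apply, DirectSum.toSemiring_of]
  rfl

theorem quotientGrading.components_eq_zero {a : A} (ha : a ∈ I.toIdeal) :
    quotientGrading.components 𝒜 I a = 0 := by
  classical
  conv_lhs => rw [← DirectSum.sum_support_decompose 𝒜 a]
  rw [map_sum]
  refine Finset.sum_eq_zero fun i _ => ?_
  rw [quotientGrading.components_of_mem 𝒜 I (DirectSum.decompose 𝒜 a i).2]
  have h : (⟨Ideal.Quotient.mk _ (DirectSum.decompose 𝒜 a i : A),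
      ⟨_, (DirectSum.decompose 𝒜 a i).2, rfl⟩⟩ : quotientGrading 𝒜 I i) = 0 :=
    Subtype.ext (Ideal.Quotient.eq_zero_iff_mem.2 (I.isHomogeneous i ha))
  rw [h, map_zero]

instance quotientGrading.gradedAlgebra : GradedAlgebra (quotientGrading 𝒜 I) :=
  GradedAlgebra.ofAlgHom _
    (Ideal.Quotient.liftₐ I.toIdeal (quotientGrading.components 𝒜 I)
      (fun _ ha => quotientGrading.components_eq_zero 𝒜 I ha))
    (by
      classical
      refine AlgHom.ext fun x => ?_
      obtain ⟨a, rfl⟩ := Ideal.Quotient.mk_surjective x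
      change DirectSum.coeAlgHom (quotientGrading 𝒜 I) (quotientGrading.components 𝒜 I a) =
        Ideal.Quotient.mk _ a
      induction a using DirectSum.Decomposition.inductionOn 𝒜 with
      | zero => simp
      | homogeneous a =>
        rw [quotientGrading.components_of_mem 𝒜 I a.2, DirectSum.coeAlgHom_of]
      | add a b ha hb => rw [map_add, map_add, map_add, ha, hb])
    (by
      rintro i ⟨_, a, ha, rfl⟩
      exact quotientGrading.components_of_mem 𝒜 I ha)

/-- The closed subscheme `V₊(I) = Proj (A ⧸ I)` of `Proj A`. -/
def projZeroLocus : Scheme.{u} :=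
  Proj (quotientGrading 𝒜 I)

/-- The structure morphism `V₊(I) ⟶ Spec k`. -/
def projZeroLocus.toSpec : projZeroLocus 𝒜 I ⟶ Spec (CommRingCat.of k) :=
  Proj.toSpecZero (quotientGrading 𝒜 I) ≫
    Spec.map (CommRingCat.ofHom (algebraMap k (quotientGrading 𝒜 I 0)))

end GradedQuotient

/-! ## Fermat–Pfister hypersurfaces -/

attribute [local instance] MvPolynomial.gradedAlgebra

/-- The Fermat–Pfister form of degree `m` with coefficients `∏ i, (-χ i) ^ ε i`; the variable
attached to `ε` has index `φ ε = ∑ i, ε i * 2 ^ i` (with `i` starting from `0`), which is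
`finFunctionFinEquiv ε`. -/
def fermatPfisterForm {L : Type u} [Field L] (m n : ℕ) (χ : Fin n → Lˣ) :
    MvPolynomial (Fin (2 ^ n)) L :=
  ∑ ε : Fin n → Fin 2,
    MvPolynomial.C (∏ i, (-(χ i : L)) ^ (ε i : ℕ)) *
      MvPolynomial.X (finFunctionFinEquiv ε) ^ m

theorem fermatPfisterForm_isHomogeneous {L : Type u} [Field L] (m n : ℕ) (χ : Fin n → Lˣ) :
    (fermatPfisterForm m n χ).IsHomogeneous m :=
  MvPolynomial.IsHomogeneous.sum _ _ _ fun _ _ =>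
    MvPolynomial.isHomogeneous_C_mul_X_pow _ _ m

/-- The homogeneous ideal generated by the Fermat–Pfister form. -/
def fermatPfisterIdeal {L : Type u} [Field L] (m n : ℕ) (χ : Fin n → Lˣ) :
    HomogeneousIdeal (MvPolynomial.homogeneousSubmodule (Fin (2 ^ n)) L) where
  toSubmodule := Ideal.span {fermatPfisterForm m n χ}
  is_homogeneous' := Ideal.homogeneous_span _ _ (by
    rintro _ rfl
    exact ⟨m, fermatPfisterForm_isHomogeneous m n χ⟩)

/-- The hypersurface in the projective space of dimension `2 ^ n - 1` over `L` that is cut out by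
the Fermat–Pfister form. -/
def fermatPfisterHypersurface {L : Type u} [Field L] (m n : ℕ) (χ : Fin n → Lˣ) : Scheme.{u} :=
  projZeroLocus (MvPolynomial.homogeneousSubmodule (Fin (2 ^ n)) L) (fermatPfisterIdeal m n χ)

/-- The structure morphism of the Fermat–Pfister hypersurface. -/
def fermatPfisterHypersurface.toSpec {L : Type u} [Field L] (m n : ℕ) (χ : Fin n → Lˣ) :
    fermatPfisterHypersurface m n χ ⟶ Spec (CommRingCat.of L) :=
  projZeroLocus.toSpec _ (fermatPfisterIdeal m n χ)

/-! ## Function fields -/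

/-- The inclusion `L → L(Y)` of the base field into the function field of an irreducible scheme
`Y` over `L`: a scalar is pulled back to a global function on `Y`, and then restricted to the
generic point. -/
def toFunctionField {L : Type u} [Field L] {Y : Scheme.{u}} [IrreducibleSpace Y]
    (f : Y ⟶ Spec (CommRingCat.of L)) : L →+* Y.functionField :=
  ((Scheme.ΓSpecIso (CommRingCat.of L)).inv ≫ f.appTop ≫
    Y.presheaf.germ ⊤ (genericPoint Y) trivial).hom

end

noncomputable section

/-! ## Symbols in Milnor K-theory modulo `m` -/

/-! Symbols: a morphism `Y → X`, restricted to the generic point, gives a nontrivial zero of the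
form over `F = L(Y)` (`exists_sum_mul_pow_eq_zero_of_hom`). The form in `k + 1` parameters splits as
`A - χ B`, with `A` and `B` values of the form in the first `k`. Induction on `k` shows that `(χ₁,
…, χₖ, w, …)` dies modulo `m` for each nonzero value `w`, and that `(χ₁, …, χₖ, …)` dies once there
is a nontrivial zero (`milnorSymbol_eq_zero_of_fermatPfisterValue`). For values, the Steinberg
relation is applied to `χB/A + w/A = 1`; for zeros, either `A = B = 0` or `χ = A/B`. With no
parameters the values are `m`-th powers.

Smoothness: this holds for every diagonal form with nonzero coefficients when `m` is invertible. The
charts `xᵢxⱼ ≠ 0` with `i ≠ j` cover the hypersurface. After setting `xᵢ = 1`, the derivative in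
`xⱼ` is a unit there, so one Newton step lifts points along square-zero ideals
(`smooth_coordinateChart`). -/

/-- A bimultiplicative map on the units of a ring, with values in an additive group, which
satisfies the Steinberg relation. -/
structure SteinbergSymbol (F : Type*) [CommRing F] (G : Type*) [AddCommGroup G] where
  /-- The underlying map. -/
  toFun : Fˣ → Fˣ → G
  mul_left : ∀ x x' y, toFun (x * x') y = toFun x y + toFun x' y
  mul_right : ∀ x y y', toFun x (y * y') = toFun x y + toFun x y'
  steinberg : ∀ x y : Fˣ, (x : F) + y = 1 → toFun x y = 0

namespace SteinbergSymbol

variable {F G : Type*} [AddCommGroup G]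

section CommRing

variable [CommRing F] (S : SteinbergSymbol F G)

theorem one_left (y : Fˣ) : S.toFun 1 y = 0 := by
  simpa using S.mul_left 1 1 y

theorem one_right (x : Fˣ) : S.toFun x 1 = 0 := by
  simpa using S.mul_right x 1 1

theorem inv_left (x y : Fˣ) : S.toFun x⁻¹ y = -S.toFun x y := by
  rw [eq_neg_iff_add_eq_zero, ← S.mul_left, inv_mul_cancel, S.one_left]

theorem inv_right (x y : Fˣ) : S.toFun x y⁻¹ = -S.toFun x y := by
  rw [eq_neg_iff_add_eq_zero, ← S.mul_right, inv_mul_cancel, S.one_right]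

end CommRing

variable [Field F] (S : SteinbergSymbol F G)

theorem neg_right (x : Fˣ) : S.toFun x (-x) = 0 := by
  by_cases hx : x = 1
  · rw [hx, S.one_left]
  have h1 : (1 : F) - x ≠ 0 := fun h => hx (Units.ext (sub_eq_zero.1 h).symm)
  have h2 : (1 : F) - (x⁻¹ : Fˣ) ≠ 0 := fun h =>
    hx (inv_eq_one.1 (Units.ext (sub_eq_zero.1 h).symm))
  -- The classical identity `-x = (1 - x) / (1 - x⁻¹)`; it needs `x ≠ 1`.
  have h : -x = Units.mk0 _ h1 * (Units.mk0 _ h2)⁻¹ := by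
    rw [eq_mul_inv_iff_mul_eq]
    ext
    simp only [Units.val_mul, Units.val_neg, Units.val_mk0, mul_sub, mul_one, neg_mul,
      Units.mul_inv]
    ring
  have h3 : S.toFun x (Units.mk0 _ h2) = 0 := by
    rw [← neg_eq_zero, ← S.inv_left, S.steinberg _ _ (by simp)]
  rw [h, S.mul_right, S.inv_right, S.steinberg _ _ (by simp), h3, neg_zero, add_zero]

/-- Expand `S(xy, -xy) = 0` bilinearly and discard the terms `S(x, -x)` and `S(y, -y)`. -/
theorem swap (x y : Fˣ) : S.toFun x y = -S.toFun y x := by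
  have h := S.neg_right (x * y)
  have h1 : -(x * y) = -x * y := by simp
  have h2 : S.toFun y (-x * y) = S.toFun y x := by
    rw [show -x * y = x * -y by simp, S.mul_right, S.neg_right, add_zero]
  rw [h1, S.mul_left, h2, S.mul_right, S.neg_right, zero_add] at h
  exact eq_neg_of_add_eq_zero_left h

/-- If the symbol kills `A` and `B` (whenever they are nonzero), then it kills the pair
`(x, A - x * B)`. -/
theorem apply_sub_mul_eq_zero {A B : F} (hA : ∀ u : Fˣ, (u : F) = A → ∀ t, S.toFun u t = 0)
    (hB : ∀ u : Fˣ, (u : F) = B → ∀ t, S.toFun u t = 0) (x w : Fˣ)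
    (hw : (w : F) = A - x * B) : S.toFun x w = 0 := by
  by_cases hA0 : A = 0
  · have hB0 : B ≠ 0 := by
      rintro rfl
      exact w.ne_zero (by simp [hw, hA0])
    have : w = -x * Units.mk0 B hB0 := by ext; simp [hw, hA0]
    rw [this, S.mul_right, S.neg_right, S.swap, hB _ rfl, neg_zero, add_zero]
  by_cases hB0 : B = 0
  · rw [S.swap, hA w (by simp [hw, hB0]), neg_zero]
  set a := Units.mk0 A hA0 with ha
  set b := Units.mk0 B hB0 with hb
  have h1 : w = a * (w * a⁻¹) := by rw [mul_comm w, mul_inv_cancel_left]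
  -- Dividing `w + xB = A` by `A` gives a Steinberg pair; the factors `a` and `b` then drop out.
  have h2 : S.toFun (x * b * a⁻¹) (w * a⁻¹) = 0 := by
    refine S.steinberg _ _ ?_
    simp only [Units.val_mul, Units.val_inv_eq_inv_val, hw, ha, hb, Units.val_mk0]
    field_simp
    ring
  rw [S.mul_left, S.mul_left, S.inv_left, hA a rfl, hB b rfl, neg_zero, add_zero, add_zero] at h2
  rw [h1, S.mul_right, h2, S.swap, hA a rfl, neg_zero, add_zero]

end SteinbergSymbol

section MilnorSymbol

variable {R : Type u} [CommRing R] {N : ℕ} (m : ℕ)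

theorem nsmul_milnorKMod (x : MilnorKMod R N m) : m • x = 0 := by
  obtain ⟨y, rfl⟩ := Submodule.Quotient.mk_surjective _ x
  rw [← Submodule.Quotient.mk_smul, Submodule.Quotient.mk_eq_zero]
  exact ⟨y, by simp⟩

theorem milnorSymbol_update_mul (a : Fin N → Rˣ) (i : Fin N) (x y : Rˣ) :
    milnorSymbol m (Function.update a i (x * y)) =
      milnorSymbol m (Function.update a i x) + milnorSymbol m (Function.update a i y) := by
  have h (z : Rˣ) : (fun k => Additive.ofMul (Function.update a i z k)) =
      Function.update (fun k => Additive.ofMul (a k)) i (Additive.ofMul z) :=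
    Function.comp_update Additive.ofMul a i z
  simp only [milnorSymbol, unitsTprod, h, ofMul_mul, MultilinearMap.map_update_add]
  rfl

theorem milnorSymbol_update_one (a : Fin N → Rˣ) (i : Fin N) :
    milnorSymbol m (Function.update a i 1) = 0 := by
  simpa using milnorSymbol_update_mul m a i 1 1

theorem milnorSymbol_update_inv (a : Fin N → Rˣ) (i : Fin N) (x : Rˣ) :
    milnorSymbol m (Function.update a i x⁻¹) = -milnorSymbol m (Function.update a i x) := by
  rw [eq_neg_iff_add_eq_zero, ← milnorSymbol_update_mul, inv_mul_cancel, milnorSymbol_update_one]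

theorem milnorSymbol_update_pow (a : Fin N → Rˣ) (i : Fin N) (x : Rˣ) (k : ℕ) :
    milnorSymbol m (Function.update a i (x ^ k)) =
      k • milnorSymbol m (Function.update a i x) := by
  induction k with
  | zero => simp [milnorSymbol_update_one]
  | succ k ih => rw [pow_succ, milnorSymbol_update_mul, ih, succ_nsmul]

theorem milnorSymbol_eq_zero_of_add_eq_one (a : Fin N → Rˣ) {i j : Fin N}
    (hij : (j : ℕ) = i + 1) (h : (a i : R) + a j = 1) : milnorSymbol m a = 0 := by
  have : unitsTprod a ∈ steinbergRelations R N := Submodule.subset_span ⟨a, i, j, hij, h, rfl⟩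
  rw [milnorSymbol, (Submodule.Quotient.mk_eq_zero _).2 this, Submodule.Quotient.mk_zero]

/-- The symbol as a function of two consecutive entries. -/
def consecutiveSymbol (a : Fin N → Rˣ) {i j : Fin N} (hij : (j : ℕ) = i + 1) :
    SteinbergSymbol R (MilnorKMod R N m) where
  toFun x y := milnorSymbol m (Function.update (Function.update a i x) j y)
  mul_left x x' y := by
    have h : i ≠ j := by
      rintro rfl
      omega
    simp only [Function.update_comm h, milnorSymbol_update_mul]
  mul_right x y y' := milnorSymbol_update_mul m _ _ _ _
  steinberg x y h := by
    have hne : i ≠ j := by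
      rintro rfl
      omega
    exact milnorSymbol_eq_zero_of_add_eq_one m _ hij (by simpa [Function.update_of_ne hne] using h)

end MilnorSymbol

/-! ## Values of Fermat–Pfister forms -/

/-- The value at `y` of the Fermat–Pfister form with coefficients `∏ i, (-χ i) ^ ε i`. -/
def fermatPfisterValue {F : Type*} [CommRing F] (m : ℕ) {k : ℕ} (χ : Fin k → F)
    (y : (Fin k → Fin 2) → F) : F :=
  ∑ ε : Fin k → Fin 2, (∏ i, (-χ i) ^ (ε i : ℕ)) * y ε ^ m

theorem fermatPfisterValue_succ {F : Type*} [CommRing F] (m : ℕ) {k : ℕ} (χ : Fin (k + 1) → F)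
    (y : (Fin (k + 1) → Fin 2) → F) :
    fermatPfisterValue m χ y =
      fermatPfisterValue m (fun i => χ i.castSucc) (fun ε => y (Fin.snoc ε 0)) -
        χ (Fin.last k) *
          fermatPfisterValue m (fun i => χ i.castSucc) (fun ε => y (Fin.snoc ε 1)) := by
  simp only [fermatPfisterValue]
  rw [← (Fin.snocEquiv fun _ : Fin (k + 1) => Fin 2).sum_comp, Fintype.sum_prod_type,
    Fin.sum_univ_two, Finset.mul_sum, sub_eq_add_neg, ← Finset.sum_neg_distrib]
  simp only [Fin.snocEquiv, Equiv.coe_fn_mk, Fin.prod_univ_castSucc, Fin.snoc_castSucc,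
    Fin.snoc_last]
  congr 1
  · simp
  · refine Finset.sum_congr rfl fun ε _ => ?_
    simp
    ring

/-- The length `N` stays fixed and the entries beyond the prescribed ones are arbitrary, so the
induction on `k` needs no products of symbols. Both claims are proved together because the second at
`k + 1` uses both at `k`. -/
theorem milnorSymbol_eq_zero_of_fermatPfisterValue {F : Type u} [Field F] (m N : ℕ) {k : ℕ}
    (χ : Fin k → Fˣ) (y : (Fin k → Fin 2) → F) :
    (∀ (a : Fin N → Fˣ) (hk : k < N), (∀ i : Fin k, a ⟨i, i.2.trans hk⟩ = χ i) →
      (a ⟨k, hk⟩ : F) = fermatPfisterValue m (fun i => (χ i : F)) y → milnorSymbol m a = 0) ∧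
    (m ≠ 0 → y ≠ 0 → fermatPfisterValue m (fun i => (χ i : F)) y = 0 →
      ∀ (a : Fin N → Fˣ) (hk : k ≤ N), (∀ i : Fin k, a ⟨i, i.2.trans_le hk⟩ = χ i) →
        milnorSymbol m a = 0) := by
  induction k with
  | zero =>
    have hv : fermatPfisterValue m (fun i => (χ i : F)) y = y default ^ m := by
      simp only [fermatPfisterValue, Fintype.sum_unique, Fin.prod_univ_zero, one_mul]
      exact congrArg (fun ε => y ε ^ m) (Subsingleton.elim _ _)
    refine ⟨fun a hk _ h => ?_, fun hm hy h => ?_⟩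
    · rw [hv] at h
      by_cases hm : m = 0
      · have : a ⟨0, hk⟩ = 1 := Units.ext (by simp [h, hm])
        rw [← Function.update_eq_self ⟨0, hk⟩ a, this, milnorSymbol_update_one]
      have hy : y default ≠ 0 := by
        intro h0
        exact (a ⟨0, hk⟩).ne_zero (by rw [h, h0, zero_pow hm])
      have : a ⟨0, hk⟩ = Units.mk0 _ hy ^ m := Units.ext (by simp [h])
      rw [← Function.update_eq_self ⟨0, hk⟩ a, this, milnorSymbol_update_pow, nsmul_milnorKMod]
    · rw [hv] at h
      refine absurd (funext fun ε => ?_) hy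
      rw [Subsingleton.elim ε default, eq_zero_of_pow_eq_zero h, Pi.zero_apply]
  | succ k ih =>
    have hv := fermatPfisterValue_succ m (fun i => (χ i : F)) y
    set A := fermatPfisterValue m (fun i : Fin k => (χ i.castSucc : F))
      (fun ε => y (Fin.snoc ε 0)) with hA
    set B := fermatPfisterValue m (fun i : Fin k => (χ i.castSucc : F))
      (fun ε => y (Fin.snoc ε 1)) with hB
    have ih0 := ih (fun i => χ i.castSucc) (fun ε => y (Fin.snoc ε 0))
    have ih1 := ih (fun i => χ i.castSucc) (fun ε => y (Fin.snoc ε 1))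
    refine ⟨fun a hk ha h => ?_, fun hm hy h a hk ha => ?_⟩
    · have hk' : k < N := by omega
      -- Only slots `k` and `k + 1` vary. The induction hypothesis says that `A` or `B` in slot `k`
      -- kills the symbol whatever stands in slot `k + 1`.
      set S := consecutiveSymbol m a (i := ⟨k, hk'⟩) (j := ⟨k + 1, hk⟩) rfl
      have key : S.toFun (χ (Fin.last k)) (a ⟨k + 1, hk⟩) = 0 := by
        refine S.apply_sub_mul_eq_zero (A := A) (B := B) (fun u hu t => ?_) (fun u hu t => ?_) _ _
          (h.trans hv)
        · refine ih0.1 _ hk' (fun i => ?_) ?_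
          · rw [Function.update_of_ne (by simp [Fin.ext_iff]; omega),
              Function.update_of_ne (by simp [Fin.ext_iff]; omega), ← ha i.castSucc]
            rfl
          · rw [Function.update_of_ne (by simp [Fin.ext_iff]), Function.update_self, hu]
        · refine ih1.1 _ hk' (fun i => ?_) ?_
          · rw [Function.update_of_ne (by simp [Fin.ext_iff]; omega),
              Function.update_of_ne (by simp [Fin.ext_iff]; omega), ← ha i.castSucc]
            rfl
          · rw [Function.update_of_ne (by simp [Fin.ext_iff]), Function.update_self, hu]
      rw [← ha (Fin.last k)] at key
      have : Function.update (Function.update a ⟨k, hk'⟩ (a ⟨k, hk'⟩)) ⟨k + 1, hk⟩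
          (a ⟨k + 1, hk⟩) = a := by simp
      rw [← this]
      exact key
    · rw [hv, sub_eq_zero] at h
      have hk' : k < N := hk
      by_cases hA0 : A = 0
      · have hB0 : B = 0 := by
          rw [hA0] at h
          exact (mul_eq_zero.1 h.symm).resolve_left (Units.ne_zero _)
        -- The last bit of an index with nonzero coordinate tells which half of `y` is a nontrivial
        -- zero of the smaller form.
        obtain ⟨ε, hε⟩ := Function.ne_iff.1 hy
        have hεs : y (Fin.snoc (fun i => ε i.castSucc) (ε (Fin.last k))) ≠ 0 := by
          rw [show (Fin.snoc (fun i => ε i.castSucc) (ε (Fin.last k)) : Fin (k + 1) → Fin 2) = ε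
            from Fin.snoc_init_self ε]
          exact hε
        have h01 : ε (Fin.last k) = 0 ∨ ε (Fin.last k) = 1 := by omega
        rcases h01 with h0 | h1
        · rw [h0] at hεs
          exact ih0.2 hm (Function.ne_iff.2 ⟨_, hεs⟩) hA0 a hk'.le fun i => ha i.castSucc
        · rw [h1] at hεs
          exact ih1.2 hm (Function.ne_iff.2 ⟨_, hεs⟩) hB0 a hk'.le fun i => ha i.castSucc
      · have hB0 : B ≠ 0 := by
          intro hB0
          exact hA0 (by rw [h, hB0, mul_zero])
        -- The entry is a quotient of two nonzero values, so the symbol is a difference of two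
        -- symbols killed by the first claim.
        have hχ : a ⟨k, hk'⟩ = Units.mk0 A hA0 * (Units.mk0 B hB0)⁻¹ := by
          rw [eq_mul_inv_iff_mul_eq, show a ⟨k, hk'⟩ = χ (Fin.last k) from ha (Fin.last k)]
          exact Units.ext (by simp [h])
        rw [← Function.update_eq_self ⟨k, hk'⟩ a, hχ, milnorSymbol_update_mul,
          milnorSymbol_update_inv, ih0.1 _ hk' (fun i => ?_) (by simp [hA]),
          ih1.1 _ hk' (fun i => ?_) (by simp [hB]), neg_zero, add_zero]
        all_goals
          rw [Function.update_of_ne (by simp [Fin.ext_iff]; omega), ← ha i.castSucc]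
          rfl

attribute [local instance] MvPolynomial.gradedAlgebra

/-! ## Affine charts of projective schemes over a ring -/

open HomogeneousLocalization

section AwayAlgebra

variable {k A : Type u} [CommRing k] [CommRing A] [Algebra k A]
  (𝒜 : ℕ → Submodule k A) [GradedAlgebra 𝒜]

/-- The structure map of the degree zero part of `A_f` as an algebra over the base ring. -/
def awayStructureMap (f : A) : k →+* Away 𝒜 f :=
  (fromZeroRingHom 𝒜 (Submonoid.powers f)).comp (algebraMap k (𝒜 0))

theorem val_awayMk {f : A} {d : ℕ} (hf : f ∈ 𝒜 d) (n : ℕ) (a : A) (ha : a ∈ 𝒜 (n • d)) :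
    (Away.mk 𝒜 hf n a ha).val =
      algebraMap A (Localization.Away f) a * IsLocalization.Away.invSelf f ^ n := by
  rw [Away.val_mk, Localization.mk_eq_mk', IsLocalization.mk'_eq_iff_eq_mul, map_pow, mul_assoc,
    ← mul_pow, mul_comm (IsLocalization.Away.invSelf f), IsLocalization.Away.mul_invSelf, one_pow,
    mul_one]

end AwayAlgebra

theorem MvPolynomial.IsHomogeneous.eval₂_mul {σ R S : Type*} [CommSemiring R] [CommSemiring S]
    {F : MvPolynomial σ R} {n : ℕ} (hF : F.IsHomogeneous n) (f : R →+* S) (g : σ → S) (t : S) :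
    MvPolynomial.eval₂ f (fun i => g i * t) F = MvPolynomial.eval₂ f g F * t ^ n := by
  rw [MvPolynomial.eval₂_eq, MvPolynomial.eval₂_eq, Finset.sum_mul]
  refine Finset.sum_congr rfl fun d hd => ?_
  rw [mul_assoc]
  congr 1
  simp_rw [mul_pow]
  rw [Finset.prod_mul_distrib, Finset.prod_pow_eq_pow_sum]
  congr 2
  have := hF (MvPolynomial.mem_support_iff.1 hd)
  simpa [Finsupp.weight_apply, Finsupp.sum] using this

section Charts

variable {L : Type u} [Field L] {σ : Type}
  (I : HomogeneousIdeal (MvPolynomial.homogeneousSubmodule σ L))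

/-- The grading on the homogeneous coordinate ring of `V₊(I)`. -/
abbrev coordinateGrading : ℕ → Submodule L (MvPolynomial σ L ⧸ I.toIdeal) :=
  quotientGrading (MvPolynomial.homogeneousSubmodule σ L) I

/-- The homogeneous coordinates on `V₊(I)`. -/
def homogeneousCoordinate (k : σ) : MvPolynomial σ L ⧸ I.toIdeal :=
  Ideal.Quotient.mk _ (MvPolynomial.X k)

theorem homogeneousCoordinate_mem (k : σ) : homogeneousCoordinate I k ∈ coordinateGrading I 1 :=
  ⟨_, MvPolynomial.isHomogeneous_X L k, rfl⟩

theorem mk_eq_eval₂_homogeneousCoordinate (F : MvPolynomial σ L) :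
    Ideal.Quotient.mk I.toIdeal F =
      MvPolynomial.eval₂ (algebraMap L (MvPolynomial σ L ⧸ I.toIdeal))
        (homogeneousCoordinate I) F := by
  have : Ideal.Quotient.mkₐ L I.toIdeal = MvPolynomial.aeval (homogeneousCoordinate I) :=
    MvPolynomial.algHom_ext fun k => by simp [homogeneousCoordinate]
  exact DFunLike.congr_fun this F

variable (i j : σ)

/-- The product of two homogeneous coordinates. -/
abbrev coordinateProd : MvPolynomial σ L ⧸ I.toIdeal :=
  homogeneousCoordinate I i * homogeneousCoordinate I j

theorem coordinateProd_mem : coordinateProd I i j ∈ coordinateGrading I (1 + 1) :=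
  SetLike.mul_mem_graded (homogeneousCoordinate_mem I i) (homogeneousCoordinate_mem I j)

/-- The coordinate ring of the chart where the coordinates `i` and `j` do not vanish. -/
abbrev CoordinateChart : Type u := Away (coordinateGrading I) (coordinateProd I i j)

instance : Algebra L (CoordinateChart I i j) :=
  (awayStructureMap (coordinateGrading I) (coordinateProd I i j)).toAlgebra

/-- The fraction `x_k x_l / (x_i x_j)`. -/
def coordinateRatio (k l : σ) : CoordinateChart I i j :=
  Away.mk (coordinateGrading I) (coordinateProd_mem I i j) 1 (coordinateProd I k l)
    (by simpa using coordinateProd_mem I k l)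

theorem val_coordinateRatio (k l : σ) :
    (coordinateRatio I i j k l).val =
      algebraMap _ (Localization.Away (coordinateProd I i j)) (coordinateProd I k l) *
        IsLocalization.Away.invSelf (coordinateProd I i j) := by
  rw [coordinateRatio, val_awayMk, pow_one]

theorem coordinateRatio_self : coordinateRatio I i j i j = 1 := by
  ext
  rw [val_coordinateRatio, IsLocalization.Away.mul_invSelf, val_one]

theorem coordinateRatio_mul : coordinateRatio I i j j j * coordinateRatio I i j i i = 1 := by
  ext
  rw [val_mul, val_coordinateRatio, val_coordinateRatio, val_one]
  have h := IsLocalization.Away.mul_invSelf (S := Localization.Away (coordinateProd I i j))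
    (coordinateProd I i j)
  simp only [map_mul] at h ⊢
  -- With `u = xᵢxⱼw`, this is `u² - 1 = (u + 1)(u - 1)`.
  linear_combination (algebraMap _ (Localization.Away (coordinateProd I i j))
    (homogeneousCoordinate I i) * algebraMap _ (Localization.Away (coordinateProd I i j))
    (homogeneousCoordinate I j) * IsLocalization.Away.invSelf (coordinateProd I i j) + 1) * h

/-- For `F` of degree `2n`, `F / (xᵢxⱼ)ⁿ = F(xₖ/xᵢ) · (xᵢ/xⱼ)ⁿ`. -/
theorem exists_eq_aeval_coordinateRatio (x : CoordinateChart I i j) :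
    ∃ (F : MvPolynomial σ L) (n : ℕ), x =
      MvPolynomial.aeval (fun k => coordinateRatio I i j k j) F * coordinateRatio I i j i i ^ n := by
  obtain ⟨n, b, hb, rfl⟩ := Away.mk_surjective _ (coordinateProd_mem I i j) x
  obtain ⟨F, hF, hFb⟩ := id hb
  refine ⟨F, n, ?_⟩
  ext
  set w := IsLocalization.Away.invSelf (S := Localization.Away (coordinateProd I i j))
    (coordinateProd I i j)
  set α := algebraMap (MvPolynomial σ L ⧸ I.toIdeal)
    (Localization.Away (coordinateProd I i j))
  have h : α (homogeneousCoordinate I i) * α (homogeneousCoordinate I j) * w = 1 := by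
    rw [← map_mul]
    exact IsLocalization.Away.mul_invSelf _
  have h1 : (MvPolynomial.aeval (fun k => coordinateRatio I i j k j) F).val =
      α (Ideal.Quotient.mk _ F) * (α (homogeneousCoordinate I j) * w) ^ (n • (1 + 1)) := by
    rw [mk_eq_eval₂_homogeneousCoordinate, MvPolynomial.hom_eval₂,
      ← MvPolynomial.IsHomogeneous.eval₂_mul hF]
    change algebraMap (CoordinateChart I i j) (Localization.Away (coordinateProd I i j)) _ = _
    rw [MvPolynomial.aeval_def, MvPolynomial.hom_eval₂]
    congr 1
    funext k
    change (coordinateRatio I i j k j).val = _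
    rw [val_coordinateRatio, map_mul, mul_assoc]
  rw [val_awayMk, val_mul, val_pow, val_coordinateRatio, h1, map_mul, ← hFb]
  change α (Ideal.Quotient.mk _ F) * w ^ n = _ * (α _ * α _ * w) ^ n
  have h2 : (α (homogeneousCoordinate I j) * w) ^ (n • (1 + 1)) *
      (α (homogeneousCoordinate I i) * α (homogeneousCoordinate I i) * w) ^ n =
      (α (homogeneousCoordinate I i) * α (homogeneousCoordinate I j) * w) ^ (n + n) * w ^ n := by
    simp only [smul_eq_mul, mul_add, mul_one, pow_add, mul_pow]
    ring
  rw [mul_assoc, h2, h, one_pow, one_mul]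

theorem adjoin_coordinateRatio :
    Algebra.adjoin L (insert (coordinateRatio I i j i i)
      (Set.range fun k => coordinateRatio I i j k j)) = ⊤ := by
  refine top_le_iff.1 fun x _ => ?_
  obtain ⟨F, n, rfl⟩ := exists_eq_aeval_coordinateRatio I i j x
  refine mul_mem ?_ (pow_mem (Algebra.subset_adjoin (Set.mem_insert _ _)) _)
  refine Algebra.adjoin_mono (Set.subset_insert _ _) ?_
  rw [Algebra.adjoin_range_eq_range_aeval]
  exact ⟨F, rfl⟩

theorem finiteType_coordinateChart [Finite σ] : Algebra.FiniteType L (CoordinateChart I i j) :=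
  ⟨(Subalgebra.fg_def).2 ⟨_, (Set.finite_range _).insert _, adjoin_coordinateRatio I i j⟩⟩

-- The remaining generator `xᵢ/xⱼ` is the inverse of `xⱼ/xᵢ`, so its image is forced.
variable {I i j} in
theorem coordinateChart_algHom_ext {C : Type*} [CommRing C] [Algebra L C]
    {φ ψ : CoordinateChart I i j →ₐ[L] C}
    (h : ∀ k, φ (coordinateRatio I i j k j) = ψ (coordinateRatio I i j k j)) : φ = ψ := by
  refine AlgHom.ext_of_adjoin_eq_top (adjoin_coordinateRatio I i j) ?_
  rintro _ (rfl | ⟨k, rfl⟩)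
  · have h1 := congrArg φ (coordinateRatio_mul I i j)
    have h2 := congrArg ψ (coordinateRatio_mul I i j)
    rw [map_mul, map_one] at h1 h2
    rw [← h j] at h2
    rw [mul_comm] at h1
    exact left_inv_eq_right_inv h1 h2
  · exact h k

-- With the preceding uniqueness, this gives the functor of points of the chart: zeros of `I` with
-- `i`-th coordinate `1` and `j`-th coordinate a unit.
variable {I i j} in
theorem exists_coordinateChart_algHom {C : Type*} [CommRing C] [Algebra L C] (a : σ → C)
    (ha : ∀ F ∈ I, MvPolynomial.aeval a F = 0) (hi : a i = 1) (hj : IsUnit (a j)) :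
    ∃ φ : CoordinateChart I i j →ₐ[L] C, ∀ k, φ (coordinateRatio I i j k j) = a k := by
  let ψ : MvPolynomial σ L ⧸ I.toIdeal →ₐ[L] C := Ideal.Quotient.liftₐ _ (MvPolynomial.aeval a) ha
  have hψ (k : σ) : ψ (homogeneousCoordinate I k) = a k := MvPolynomial.aeval_X a k
  have hs : IsUnit ((ψ : _ →+* C) (coordinateProd I i j)) := by
    simpa [hψ, hi] using hj
  let θ : Localization.Away (coordinateProd I i j) →+* C := IsLocalization.Away.lift _ hs
  have hθ (x) : θ (algebraMap _ _ x) = ψ x := IsLocalization.Away.lift_eq _ hs x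
  refine ⟨{ θ.comp (algebraMap (CoordinateChart I i j) _) with
    commutes' := fun r => (hθ _).trans (ψ.commutes r) }, fun k => ?_⟩
  change θ (coordinateRatio I i j k j).val = a k
  have h := congrArg θ (IsLocalization.Away.mul_invSelf
    (S := Localization.Away (coordinateProd I i j)) (coordinateProd I i j))
  rw [map_mul, map_one, hθ, map_mul, hψ, hψ, hi, one_mul] at h
  rw [val_coordinateRatio, map_mul, hθ, map_mul, hψ, hψ, mul_assoc, h, mul_one]

end Charts

/-! ## Diagonal forms -/

/-- A unit modulo a square zero ideal is a unit. -/
theorem isUnit_of_mul_sub_one_mem {C : Type*} [CommRing C] {J : Ideal C} (hJ : J ^ 2 = ⊥) {a b : C}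
    (h : a * b - 1 ∈ J) : IsUnit a := by
  have h2 : (a * b - 1) ^ 2 = 0 := by
    rw [← Ideal.mem_bot, ← hJ]
    exact Ideal.pow_mem_pow h 2
  exact IsUnit.of_mul_eq_one (b * (2 - a * b)) (by linear_combination -h2)

-- One Newton step in the variable `j`: the correction is minus the value over the derivative, and
-- the Taylor remainder is a multiple of its square, which is zero.
theorem exists_sum_mul_pow_eq_zero {C σ : Type*} [CommRing C] [Fintype σ] [DecidableEq σ]
    {J : Ideal C} (hJ : J ^ 2 = ⊥) (m : ℕ) (c a : σ → C) (j : σ)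
    (ha : ∑ k, c k * a k ^ m ∈ J) (hu : IsUnit (c j * (m * a j ^ (m - 1)))) :
    ∃ h ∈ J, ∑ k, c k * Function.update a j (a j + h) k ^ m = 0 := by
  obtain ⟨u, hu⟩ := hu
  set r := ∑ k, c k * a k ^ m with hr
  have hh : -r * (u⁻¹ : Cˣ) ∈ J := J.mul_mem_right _ (J.neg_mem ha)
  refine ⟨_, hh, ?_⟩
  have h2 : (-r * (u⁻¹ : Cˣ)) ^ 2 = 0 := by
    rw [← Ideal.mem_bot, ← hJ]
    exact Ideal.pow_mem_pow hh 2
  obtain ⟨q, hq⟩ := Polynomial.powAddExpansion (a j) (-r * (u⁻¹ : Cˣ)) m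
  rw [h2, mul_zero, add_zero] at hq
  rw [← Finset.add_sum_erase _ _ (Finset.mem_univ j)] at hr ⊢
  rw [Finset.sum_congr rfl fun k hk => by
    rw [Function.update_of_ne (Finset.ne_of_mem_erase hk)], Function.update_self, hq]
  have hu' : (u : C) * (u⁻¹ : Cˣ) = 1 := u.mul_inv
  rw [hu] at hu'
  linear_combination -hr - r * hu'

section Diagonal

variable {L : Type u} [Field L] {σ : Type} [Fintype σ]
  (I : HomogeneousIdeal (MvPolynomial.homogeneousSubmodule σ L)) {m : ℕ} {c : σ → L}
  (hI : I.toIdeal = Ideal.span {∑ k, MvPolynomial.C (c k) * MvPolynomial.X k ^ m})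

-- Divide the form by `xᵢᵐ`; in the localization `1/xᵢ` is `xⱼ · (xᵢxⱼ)⁻¹`.
include hI in
theorem sum_coordinateRatio_pow (i j : σ) :
    ∑ k, algebraMap L (CoordinateChart I i j) (c k) * coordinateRatio I i j k j ^ m = 0 := by
  ext
  change algebraMap (CoordinateChart I i j) (Localization.Away (coordinateProd I i j)) _ = _
  have h : Ideal.Quotient.mk I.toIdeal
      (∑ k, MvPolynomial.C (c k) * MvPolynomial.X k ^ m) = 0 :=
    Ideal.Quotient.eq_zero_iff_mem.2 (hI ▸ Ideal.subset_span rfl)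
  have h' := congrArg (algebraMap _ (Localization.Away (coordinateProd I i j))) h
  rw [map_zero, map_sum, map_sum] at h'
  rw [map_sum, val_zero, ← zero_mul ((algebraMap _ (Localization.Away (coordinateProd I i j))
    (homogeneousCoordinate I j) * IsLocalization.Away.invSelf (coordinateProd I i j)) ^ m), ← h',
    Finset.sum_mul]
  refine Finset.sum_congr rfl fun k _ => ?_
  rw [map_mul, map_pow, map_mul, map_mul, map_pow, map_pow, mul_assoc, ← mul_pow]
  refine congrArg₂ (· * ·) rfl (congrArg (· ^ m) ?_)
  change (coordinateRatio I i j k j).val = _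
  rw [val_coordinateRatio, map_mul, mul_assoc]
  rfl

include hI in
theorem smooth_coordinateChart (hm : IsUnit (m : L)) (hc : ∀ k, c k ≠ 0) {i j : σ} (hij : i ≠ j) :
    Algebra.Smooth L (CoordinateChart I i j) where
  finitePresentation :=
    Algebra.FinitePresentation.of_finiteType.1 (finiteType_coordinateChart I i j)
  formallySmooth := by
    classical
    refine Algebra.FormallySmooth.of_comp_surjective fun C _ _ J hJ φ => ?_
    -- Lift the coordinates arbitrarily, reset the `i`-th to `1`, then correct the `j`-th by a
    -- Newton step; since `i ≠ j`, the normalization survives. The lift `e` of `xᵢ/xⱼ` serves to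
    -- show that lifts of `xⱼ/xᵢ` are units.
    choose b hb using fun k => Ideal.Quotient.mk_surjective (φ (coordinateRatio I i j k j))
    obtain ⟨e, he⟩ := Ideal.Quotient.mk_surjective (φ (coordinateRatio I i j i i))
    set a := Function.update b i 1 with ha
    have haφ (k) : Ideal.Quotient.mk J (a k) = φ (coordinateRatio I i j k j) := by
      by_cases hk : k = i
      · subst hk
        rw [ha, Function.update_self, coordinateRatio_self, map_one, map_one]
      · rw [ha, Function.update_of_ne hk, hb]
    have hunit {x : C} (hx : Ideal.Quotient.mk J x = φ (coordinateRatio I i j j j)) : IsUnit x := by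
      refine isUnit_of_mul_sub_one_mem (b := e) hJ ?_
      rw [← Ideal.Quotient.eq_zero_iff_mem, map_sub, map_mul, map_one, hx, he, ← map_mul,
        coordinateRatio_mul, map_one, sub_self]
    have hsum : ∑ k, algebraMap L C (c k) * a k ^ m ∈ J := by
      rw [← Ideal.Quotient.eq_zero_iff_mem, ← map_zero φ, ← sum_coordinateRatio_pow I hI i j,
        map_sum, map_sum]
      refine Finset.sum_congr rfl fun k _ => ?_
      rw [map_mul, map_pow, map_mul, map_pow, haφ, φ.commutes,
        Ideal.Quotient.mk_algebraMap]
    obtain ⟨h, hhJ, hh⟩ := exists_sum_mul_pow_eq_zero hJ m (fun k => algebraMap L C (c k)) a j hsum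
      (((hc j).isUnit.map _).mul (((map_natCast (algebraMap L C) m) ▸ hm.map (algebraMap L C)).mul
        ((hunit (haφ j)).pow _)))
    have haφ' (k) : Ideal.Quotient.mk J (Function.update a j (a j + h) k) =
        φ (coordinateRatio I i j k j) := by
      by_cases hk : k = j
      · subst hk
        rw [Function.update_self, map_add, haφ, Ideal.Quotient.eq_zero_iff_mem.2 hhJ, add_zero]
      · rw [Function.update_of_ne hk, haφ]
    have hker (F) (hF : F ∈ I) : MvPolynomial.aeval (Function.update a j (a j + h)) F = 0 := by
      have hF' : F ∈ I.toIdeal := hF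
      rw [hI, Ideal.mem_span_singleton] at hF'
      obtain ⟨q, rfl⟩ := hF'
      rw [map_mul, map_sum]
      simp [hh]
    obtain ⟨ψ, hψ⟩ := exists_coordinateChart_algHom (I := I) (i := i) (j := j) _ hker
      (by rw [Function.update_of_ne hij, ha, Function.update_self]) (hunit (haφ' j))
    refine ⟨ψ, coordinateChart_algHom_ext fun k => ?_⟩
    rw [← haφ' k, ← hψ k]
    rfl

end Diagonal

/-! ### Gluing the charts: smoothness of diagonal hypersurfaces -/

/-- The structure morphism of `Proj 𝒜` over the base ring. -/
def projToSpec {k A : Type u} [CommRing k] [CommRing A] [Algebra k A]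
    (𝒜 : ℕ → Submodule k A) [GradedAlgebra 𝒜] : Proj 𝒜 ⟶ Spec (CommRingCat.of k) :=
  Proj.toSpecZero 𝒜 ≫ Spec.map (CommRingCat.ofHom (algebraMap k (𝒜 0)))

theorem awayι_projToSpec {k A : Type u} [CommRing k] [CommRing A] [Algebra k A]
    (𝒜 : ℕ → Submodule k A) [GradedAlgebra 𝒜] {d : ℕ} {f : A} (hf : f ∈ 𝒜 d) (hd : 0 < d) :
    Proj.awayι 𝒜 f hf hd ≫ projToSpec 𝒜 =
      Spec.map (CommRingCat.ofHom (awayStructureMap 𝒜 f)) := by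
  rw [projToSpec, Proj.awayι_toSpecZero_assoc, ← Spec.map_comp]
  rfl

section Diagonal

variable {L : Type u} [Field L] {σ : Type} [Fintype σ]
  (I : HomogeneousIdeal (MvPolynomial.homogeneousSubmodule σ L)) {m : ℕ} {c : σ → L}
  (hI : I.toIdeal = Ideal.span {∑ k, MvPolynomial.C (c k) * MvPolynomial.X k ^ m})

omit [Fintype σ] in
theorem iSup_basicOpen_homogeneousCoordinate :
    ⨆ i, Proj.basicOpen (coordinateGrading I) (homogeneousCoordinate I i) = ⊤ := by
  refine Proj.iSup_basicOpen_eq_top' _ _ (fun i => ⟨1, homogeneousCoordinate_mem I i⟩) ?_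
  refine top_le_iff.1 fun x _ => ?_
  obtain ⟨F, rfl⟩ := Ideal.Quotient.mk_surjective x
  induction F using MvPolynomial.induction_on with
  | C r =>
    exact Subalgebra.algebraMap_mem _ (algebraMap L (coordinateGrading I 0) r)
  | add p q hp hq =>
    rw [map_add]
    exact add_mem (hp trivial) (hq trivial)
  | mul_X p k hp =>
    rw [map_mul]
    exact mul_mem (hp trivial) (Algebra.subset_adjoin ⟨k, rfl⟩)

-- At a point where only `xᵢ` is nonzero, the equation would force `cᵢxᵢᵐ = 0`.
include hI in
theorem iSup_basicOpen_coordinateProd (hm : m ≠ 0) (hc : ∀ k, c k ≠ 0) :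
    ⨆ p : {p : σ × σ // p.1 ≠ p.2},
      Proj.basicOpen (coordinateGrading I) (coordinateProd I p.1.1 p.1.2) = ⊤ := by
  classical
  refine top_le_iff.1 fun x _ => ?_
  have hx : x ∈ ⨆ i, Proj.basicOpen (coordinateGrading I) (homogeneousCoordinate I i) := by
    rw [iSup_basicOpen_homogeneousCoordinate]
    trivial
  obtain ⟨i, hi⟩ := TopologicalSpace.Opens.mem_iSup.1 hx
  by_contra hcon
  have hj (j : σ) (hij : i ≠ j) : homogeneousCoordinate I j ∈ x.asHomogeneousIdeal.toIdeal := by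
    by_contra hj
    refine hcon (TopologicalSpace.Opens.mem_iSup.2 ⟨⟨(i, j), hij⟩, ?_⟩)
    rw [Proj.basicOpen_mul]
    exact ⟨hi, hj⟩
  have h : Ideal.Quotient.mk I.toIdeal
      (∑ k, MvPolynomial.C (c k) * MvPolynomial.X k ^ m) = 0 :=
    Ideal.Quotient.eq_zero_iff_mem.2 (hI ▸ Ideal.subset_span rfl)
  rw [map_sum, ← Finset.add_sum_erase _ _ (Finset.mem_univ i)] at h
  have h1 : Ideal.Quotient.mk I.toIdeal (MvPolynomial.C (c i) * MvPolynomial.X i ^ m) ∈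
      x.asHomogeneousIdeal.toIdeal := by
    rw [eq_neg_of_add_eq_zero_left h]
    refine neg_mem (sum_mem fun k hk => ?_)
    rw [map_mul, map_pow]
    exact Ideal.mul_mem_left _ _
      (Ideal.pow_mem_of_mem _ (hj k (Finset.ne_of_mem_erase hk).symm) _ (Nat.pos_of_ne_zero hm))
  have hu : IsUnit (Ideal.Quotient.mk I.toIdeal (MvPolynomial.C (c i))) :=
    ((hc i).isUnit.map MvPolynomial.C).map _
  rw [map_mul, Ideal.unit_mul_mem_iff_mem _ hu, map_pow] at h1
  exact hi (x.isPrime.mem_of_pow_mem _ h1)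

include hI in
theorem smooth_projToSpec (hm : IsUnit (m : L)) (hc : ∀ k, c k ≠ 0) :
    Smooth (projToSpec (coordinateGrading I)) := by
  have hm0 : m ≠ 0 := by
    rintro rfl
    simp at hm
  have : IsZariskiLocalAtSource @Smooth.{u} :=
    HasRingHomProperty.instIsZariskiLocalAtSource (Q := RingHom.Smooth)
  refine (IsZariskiLocalAtSource.iff_of_iSup_eq_top (P := @Smooth.{u}) _
    (iSup_basicOpen_coordinateProd I hI hm0 hc)).2 fun p => ?_
  have h : (Proj.basicOpen (coordinateGrading I) (coordinateProd I p.1.1 p.1.2)).ι ≫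
      projToSpec (coordinateGrading I) =
      (Proj.basicOpenIsoSpec (coordinateGrading I) _ (coordinateProd_mem I p.1.1 p.1.2)
        (by simp)).hom ≫ Spec.map (CommRingCat.ofHom
          (awayStructureMap (coordinateGrading I) (coordinateProd I p.1.1 p.1.2))) := by
    rw [← awayι_projToSpec _ (coordinateProd_mem I p.1.1 p.1.2) (by simp),
      ← Proj.basicOpenIsoSpec_inv_ι, Category.assoc, Iso.hom_inv_id_assoc]
  have h2 : Smooth (Spec.map (CommRingCat.ofHom
      (awayStructureMap (coordinateGrading I) (coordinateProd I p.1.1 p.1.2)))) := by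
    rw [HasRingHomProperty.Spec_iff (P := @Smooth)]
    exact smooth_coordinateChart I hI hm hc p.2
  exact h ▸ smooth_comp _ _

/-! ### From morphisms to points over the function field -/

theorem fromSpecStalk_comp_eq_Spec_map {Y : Scheme.{u}} [IrreducibleSpace Y]
    (f : Y ⟶ Spec (CommRingCat.of L)) :
    Y.fromSpecStalk (genericPoint Y) ≫ f = Spec.map (CommRingCat.ofHom (toFunctionField f)) := by
  have h : f = Y.toSpecΓ ≫ Spec.map ((Scheme.ΓSpecIso (CommRingCat.of L)).inv ≫ f.appTop) := by
    rw [Spec.map_comp, ← Scheme.toSpecΓ_naturality_assoc,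
      toSpecΓ_SpecMap_ΓSpecIso_inv, Category.comp_id]
  conv_lhs => rw [h]
  rw [Scheme.fromSpecStalk_toSpecΓ_assoc, ← Spec.map_comp, toFunctionField]
  rfl

include hI in
/-- A morphism to a diagonal hypersurface gives a nontrivial zero of the form in the function
field of the source. -/
theorem exists_sum_mul_pow_eq_zero_of_hom (hm : m ≠ 0) (hc : ∀ k, c k ≠ 0) {Y : Scheme.{u}}
    [IrreducibleSpace Y] (g : Y ⟶ Proj (coordinateGrading I)) :
    ∃ y : σ → Y.functionField, (∃ i, y i = 1) ∧
      ∑ k, toFunctionField (g ≫ projToSpec (coordinateGrading I)) (c k) * y k ^ m = 0 := by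
  have hx : g (genericPoint Y) ∈ ⨆ p : {p : σ × σ // p.1 ≠ p.2},
      Proj.basicOpen (coordinateGrading I) (coordinateProd I p.1.1 p.1.2) := by
    rw [iSup_basicOpen_coordinateProd I hI hm hc]
    trivial
  obtain ⟨⟨⟨i, j⟩, hij⟩, hx⟩ := TopologicalSpace.Opens.mem_iSup.1 hx
  let α := Proj.awayι (coordinateGrading I) _ (coordinateProd_mem I i j) (by simp)
  -- Points of the spectrum of the stalk map to generizations of the generic point, and open sets
  -- are stable under generization; hence the map factors through one chart.
  have hr : Set.range (Y.fromSpecStalk (genericPoint Y) ≫ g) ⊆ Set.range α := by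
    rintro _ ⟨z, rfl⟩
    change _ ∈ α.opensRange
    rw [Proj.opensRange_awayι, Scheme.Hom.comp_apply]
    have hz : Y.fromSpecStalk (genericPoint Y) z ⤳ genericPoint Y := by
      have := Set.mem_range_self (f := Y.fromSpecStalk (genericPoint Y)) z
      rwa [Scheme.range_fromSpecStalk] at this
    exact (hz.map g.continuous).mem_open (TopologicalSpace.Opens.isOpen _) hx
  let φ := Spec.preimage (IsOpenImmersion.lift α (Y.fromSpecStalk (genericPoint Y) ≫ g) hr)
  have hφ : Spec.map φ ≫ α = Y.fromSpecStalk (genericPoint Y) ≫ g := by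
    rw [Spec.map_preimage, IsOpenImmersion.lift_fac]
  have hφL : φ.hom.comp (algebraMap L (CoordinateChart I i j)) =
      toFunctionField (g ≫ projToSpec (coordinateGrading I)) := by
    have h := fromSpecStalk_comp_eq_Spec_map (g ≫ projToSpec (coordinateGrading I))
    rw [← Category.assoc, ← hφ, Category.assoc, awayι_projToSpec, ← Spec.map_comp] at h
    exact congrArg CommRingCat.Hom.hom (Spec.map_injective h)
  -- The zero has coordinates `xₖ/xᵢ`; its `i`-th coordinate `1` makes it nontrivial.
  refine ⟨fun k => φ.hom (coordinateRatio I i j k j), ⟨i, ?_⟩, ?_⟩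
  · beta_reduce
    rw [coordinateRatio_self, map_one]
  · have h := congrArg φ.hom (sum_coordinateRatio_pow I hI i j)
    rw [map_sum, map_zero] at h
    rw [← h, ← hφL]
    exact Finset.sum_congr rfl fun k _ => by rw [map_mul, map_pow]; rfl

end Diagonal

theorem fermatPfisterIdeal_toIdeal {L : Type u} [Field L] (m n : ℕ) (χ : Fin n → Lˣ) :
    (fermatPfisterIdeal m n χ).toIdeal = Ideal.span {∑ k, MvPolynomial.C
      (∏ i, (-(χ i : L)) ^ (finFunctionFinEquiv.symm k i : ℕ)) * MvPolynomial.X k ^ m} := by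
  rw [← finFunctionFinEquiv.sum_comp]
  simp only [Equiv.symm_apply_apply]
  rfl

end

theorem corollary4p3 {L : Type u} [Field L] (m n : ℕ) (hm : 2 ≤ m) (hn : 2 ≤ n)
    (hmL : IsUnit (m : L)) (χ : Fin n → Lˣ) :
    Smooth (fermatPfisterHypersurface.toSpec m n χ) ∧
    ∀ (Y : Scheme.{u}) (f : Y ⟶ Spec (CommRingCat.of L))
      [IsIntegral Y] [IsSeparated f] [LocallyOfFiniteType f] [QuasiCompact f]
      (ι : Y ⟶ fermatPfisterHypersurface m n χ),
      ι ≫ fermatPfisterHypersurface.toSpec m n χ = f →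
        milnorSymbol m χ ∈ LinearMap.ker (milnorKModMap (toFunctionField f) n m) := by
  have hc (k : Fin (2 ^ n)) : ∏ i, (-(χ i : L)) ^ (finFunctionFinEquiv.symm k i : ℕ) ≠ 0 :=
    Finset.prod_ne_zero_iff.2 fun i _ => pow_ne_zero _ (neg_ne_zero.2 (χ i).ne_zero)
  have hI := fermatPfisterIdeal_toIdeal m n χ
  refine ⟨smooth_projToSpec _ hI hmL hc, ?_⟩
  rintro Y f _ _ _ _ ι rfl
  obtain ⟨y, ⟨i, hi⟩, hy⟩ := exists_sum_mul_pow_eq_zero_of_hom _ hI (by omega) hc ι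
  rw [LinearMap.mem_ker, milnorKModMap_symbol]
  set θ := toFunctionField (ι ≫ fermatPfisterHypersurface.toSpec m n χ)
  -- The second claim with `k = N = n`: the parameters fill the whole symbol.
  refine (milnorSymbol_eq_zero_of_fermatPfisterValue m n (fun i => Units.map (θ : L →* _) (χ i))
    (fun ε => y (finFunctionFinEquiv ε))).2 (by omega) ?_ ?_ _ le_rfl fun _ => rfl
  · exact Function.ne_iff.2 ⟨finFunctionFinEquiv.symm i, by simp [hi]⟩
  · rw [← finFunctionFinEquiv.sum_comp] at hy
    simp only [Equiv.symm_apply_apply] at hy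
    rw [← hy]
    refine Finset.sum_congr rfl fun ε _ => ?_
    congr 1
    change _ = θ _
    simp
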